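/- For a function $f:[-1,1]\to\mathbb{C}$ and $k\ge 0$ let $$a_k=\frac{1}{\pi i}\oint_{|z|=1} z^{k-1} f\big(\tfrac12(z+z^{-1})\big)\,dz$$ (with $\pi i$ replaced by $2\pi i$ when $k=0$) be its Chebyshev coefficients, let $T_k$ be the $k$-th Chebyshev polynomial of the first kind, and call $\sum_{k=0}^n a_kT_k$ the degree-$n$ Chebyshev truncation of $f$. For $t\in\mathbb{R}$ and $\varepsilon>0$ put $$B(t,\varepsilon)=\begin{cases}|t|+\dfrac{\log(1/\varepsilon)}{\log\big(e+\log(1/\varepsilon)/|t|\big)}, & \varepsilon\le 1,\\[2ex] \sqrt{\max\{0,\ |t|\log(e^{|t|}/\varepsilon)\}}, & \varepsilon>1,\end{cases}$$ where for $t=0$ and $\varepsilon\le 1$ the fraction is understood to be $0$. Theorem. There is a universal constant $C>0$ such that for all $t\in\mathbb{R}$, all $\varepsilon>0$ and all integers $n\ge 0$ with $n\ge C\,B(t,\varepsilon)$, the degree-$n$ Chebyshev truncation $p$ of the function $x\mapsto e^{tx}$ satisfies $$\max_{x\in[-1,1]}|p(x)-e^{tx}|\le\varepsilon .$$ In particular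 $n=\lceil C\,B(t,\varepsilon)\rceil$ suffices. -/

import Mathlib

open Polynomial Complex

noncomputable section

/-- The `k`-th Chebyshev coefficient of a function `f : [-1,1] → ℂ`:
`(1/(π i)) ∮_{|z|=1} z^(k-1) f((z + z⁻¹)/2) dz`, with `π i` replaced by `2 π i` when `k = 0`.
On the unit circle `(z + z⁻¹)/2` is a real number of `[-1,1]`, so taking its real part only
changes its type, and only the values of `f` on `[-1,1]` matter. -/
def chebyshevCoeff (f : ℝ → ℂ) (k : ℕ) : ℂ :=
  (if k = 0 then 2 * (Real.pi : ℂ) * I else (Real.pi : ℂ) * I)⁻¹ *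
    ∮ z in C(0, 1), z ^ ((k : ℤ) - 1) * f (((z + z⁻¹) / 2).re)

/-- The degree-`n` Chebyshev truncation `∑_{k=0}^n a_k T_k` of `f`. -/
def chebyshevTruncation (f : ℝ → ℂ) (n : ℕ) : ℂ[X] :=
  ∑ k ∈ Finset.range (n + 1),
    Polynomial.C (chebyshevCoeff f k) * Polynomial.Chebyshev.T ℂ (k : ℤ)

/-- The degree bound. For `ε ≤ 1` the second summand has the value `0` at `t = 0`, in accordance
with `log (e + ℓ / |t|) → ∞` as `t → 0` for `ℓ > 0`. For `ε > e^|t|` the radicand is truncated at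
`0`. -/
def expDegreeBound (t ε : ℝ) : ℝ :=
  if ε ≤ 1 then
    |t| + if t = 0 then 0 else
      Real.log (1 / ε) / Real.log (Real.exp 1 + Real.log (1 / ε) / |t|)
  else
    Real.sqrt (max 0 (|t| * Real.log (Real.exp |t| / ε)))

end

/-! Since `exp (t (z + z⁻¹) / 2) = ∑ I_|d|(t) z ^ d`, the Chebyshev coefficients of `exp (t x)` are
`I_0(t)` and `2 I_k(t)`, and with `S = |t|` the error is at most `besselTail n S`, which is `2
∑_{k>n} I_k(S)`. At `z = exp s` the same series gives the Chernoff bound `besselTail_le_exp`.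
Optimizing `s` settles `ε ≤ 1`, and also `ε = exp (S - δ)` with `δ ≥ 1/20`. For smaller `δ` the
Chernoff factor 2 is too costly. There the tail is at most `exp S - ∑_{k≤n} I_k(S)`, and
monotonicity of the `I_k` shows that the first `n + 1` terms carry at least the fraction `δ` of `exp
S`. -/

/-! ### Bessel generating function -/

/-- The modified Bessel function of the first kind of order `k` at a real argument. -/
noncomputable def besselI (k : ℕ) (t : ℝ) : ℝ :=
  ∑' m : ℕ, (t / 2) ^ (2 * m + k) / (m.factorial * (m + k).factorial)

/-- Pairs of naturals, parametrized by their difference and their minimum. -/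
def diffMinEquiv : ℤ × ℕ ≃ ℕ × ℕ where
  toFun p := (p.2 + p.1.toNat, p.2 + (-p.1).toNat)
  invFun q := ((q.1 : ℤ) - q.2, min q.1 q.2)
  left_inv p := by
    obtain ⟨d, m⟩ := p
    ext <;> simp <;> omega
  right_inv q := by
    obtain ⟨i, j⟩ := q
    ext <;> simp <;> omega

lemma hasSum_exp_mul_exp (a b : ℂ) :
    HasSum (fun q : ℕ × ℕ => a ^ q.1 / (q.1.factorial : ℂ) * (b ^ q.2 / (q.2.factorial : ℂ)))
      (Complex.exp a * Complex.exp b) := by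
  have h (c : ℂ) : HasSum (fun n : ℕ => c ^ n / (n.factorial : ℂ)) (Complex.exp c) := by
    rw [Complex.exp_eq_exp_ℂ]
    exact NormedSpace.expSeries_div_hasSum_exp c
  have hn (c : ℂ) : Summable (fun n : ℕ => ‖c ^ n / (n.factorial : ℂ)‖) := by
    simpa using Real.summable_pow_div_factorial ‖c‖
  generalize hf : (fun n : ℕ => a ^ n / (n.factorial : ℂ)) = f
  generalize hg : (fun n : ℕ => b ^ n / (n.factorial : ℂ)) = g
  have key : HasSum (fun q : ℕ × ℕ => f q.1 * g q.2) (Complex.exp a * Complex.exp b) :=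
    (hf ▸ h a).mul (hg ▸ h b)
      (summable_mul_of_summable_norm (f := f) (g := g) (hf ▸ hn a) (hg ▸ hn b))
  subst hf hg
  exact key

lemma summable_besselI (k : ℕ) (t : ℝ) :
    Summable fun m : ℕ => (t / 2) ^ (2 * m + k) / (m.factorial * (m + k).factorial : ℝ) := by
  have h := (Real.summable_pow_div_factorial (|t / 2|)).mul_of_nonneg
    (Real.summable_pow_div_factorial (|t / 2|)) (fun _ => by positivity) (fun _ => by positivity)
  have h2 := h.comp_injective (i := fun m : ℕ => (m, m + k)) (fun a b hab => by simpa using hab)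
  refine Summable.of_norm (h2.congr fun m => ?_)
  simp only [Function.comp, norm_div, norm_mul, norm_pow, Real.norm_eq_abs, Nat.abs_cast]
  rw [div_mul_div_comm, ← pow_add]
  rw [abs_div, abs_two]
  ring_nf

/-- Multiply the series of `exp (t z / 2)` and `exp (t z⁻¹ / 2)` and sum along the fibres `i - j =
d`. -/
lemma hasSum_besselI_zpow (t : ℝ) {z : ℂ} (hz : z ≠ 0) :
    HasSum (fun d : ℤ => (besselI d.natAbs t : ℂ) * z ^ d)
      (Complex.exp (t / 2 * (z + z⁻¹))) := by
  have h := diffMinEquiv.hasSum_iff.2 (hasSum_exp_mul_exp (t / 2 * z) (t / 2 * z⁻¹))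
  rw [← Complex.exp_add, ← mul_add] at h
  refine h.prod_fiberwise fun d => ?_
  have hb := (Complex.hasSum_ofReal.2 (summable_besselI d.natAbs t).hasSum).mul_right (z ^ d)
  convert! hb using 1
  funext m
  obtain ⟨n, rfl | rfl⟩ := d.eq_nat_or_neg
  · have e : diffMinEquiv ((n : ℤ), m) = (m + n, m) := by ext <;> simp [diffMinEquiv]
    simp only [Function.comp, e, Int.natAbs_natCast, zpow_natCast]
    push_cast
    rw [mul_pow, mul_pow, inv_pow]
    field_simp
    ring
  · have e : diffMinEquiv (-(n : ℤ), m) = (m, m + n) := by ext <;> simp [diffMinEquiv]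
    simp only [Function.comp, e, Int.natAbs_neg, Int.natAbs_natCast, zpow_neg, zpow_natCast]
    push_cast
    rw [mul_pow, mul_pow, inv_pow]
    field_simp
    ring

lemma summable_besselI_natAbs (t : ℝ) : Summable fun d : ℤ => ‖(besselI d.natAbs t : ℂ)‖ := by
  simpa using (hasSum_besselI_zpow t one_ne_zero).summable.norm

/-! ### Chebyshev coefficients and truncation error -/

lemma integral_zpow_unitCircle (d : ℤ) :
    (∮ z in C(0, 1), z ^ d) = if d = -1 then 2 * Real.pi * I else 0 := by
  split_ifs with h
  · subst h
    simpa using circleIntegral.integral_sub_center_inv (0 : ℂ) one_ne_zero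
  · simpa using circleIntegral.integral_sub_zpow_of_ne h 0 0 1

lemma circleIntegral_zpow_mul_exp (t : ℝ) (k : ℕ) :
    (∮ z in C(0, 1), z ^ ((k : ℤ) - 1) *
      Complex.exp ((t * ((z + z⁻¹) / 2).re : ℝ) : ℂ)) = 2 * Real.pi * I * besselI k t := by
  have hsum : HasSum (fun d : ℤ => ∮ z in C(0, 1),
        (besselI d.natAbs t : ℂ) * z ^ (d + ((k : ℤ) - 1)))
      (∮ z in C(0, 1), z ^ ((k : ℤ) - 1) * Complex.exp ((t * ((z + z⁻¹) / 2).re : ℝ) : ℂ)) := by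
    refine intervalIntegral.hasSum_integral_of_dominated_convergence
      (fun d _ => ‖(besselI d.natAbs t : ℂ)‖) (fun d => ?_) (fun d => ?_) ?_ ?_ ?_
    · have h : Continuous fun θ : ℝ => circleMap 0 1 θ ^ (d + ((k : ℤ) - 1)) :=
        (continuous_circleMap 0 1).zpow₀ _ fun θ => Or.inl (circleMap_ne_center one_ne_zero)
      simp only [deriv_circleMap, smul_eq_mul]
      exact Continuous.aestronglyMeasurable (by fun_prop)
    · exact Filter.Eventually.of_forall fun θ _ => by simp
    · exact Filter.Eventually.of_forall fun θ _ => summable_besselI_natAbs t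
    · exact intervalIntegrable_const
    · refine Filter.Eventually.of_forall fun θ _ => HasSum.const_smul _ ?_
      have hz : circleMap 0 1 θ ≠ 0 := circleMap_ne_center one_ne_zero
      have hn : ‖circleMap 0 1 θ‖ = 1 := by simp
      convert! (hasSum_besselI_zpow t hz).mul_left (circleMap 0 1 θ ^ ((k : ℤ) - 1)) using 1
      · funext d
        dsimp only
        rw [zpow_add₀ hz]
        ring
      -- On the unit circle `z⁻¹` is the conjugate of `z`, so taking the real part loses nothing.
      · have h2 : (((circleMap 0 1 θ + (circleMap 0 1 θ)⁻¹) / 2).re : ℂ) =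
            (circleMap 0 1 θ + (circleMap 0 1 θ)⁻¹) / 2 := by
          rw [Complex.inv_eq_conj hn, Complex.add_conj]
          simp
        dsimp only
        rw [Complex.ofReal_mul, h2]
        ring_nf
  refine hsum.unique ?_
  convert hasSum_single (f := fun d : ℤ => ∮ z in C(0, 1),
    (besselI d.natAbs t : ℂ) * z ^ (d + ((k : ℤ) - 1))) (-(k : ℤ)) ?_ using 1
  · rw [circleIntegral.integral_const_mul, integral_zpow_unitCircle, if_pos (by ring)]
    simp; ring
  · intro d hd
    rw [circleIntegral.integral_const_mul, integral_zpow_unitCircle, if_neg (by omega), mul_zero]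

lemma chebyshevCoeff_exp (t : ℝ) (k : ℕ) :
    chebyshevCoeff (fun y : ℝ => Complex.exp ((t * y : ℝ) : ℂ)) k =
      (if k = 0 then 1 else 2) * besselI k t := by
  have hpi : (Real.pi : ℂ) ≠ 0 := by exact_mod_cast Real.pi_ne_zero
  rw [chebyshevCoeff, circleIntegral_zpow_mul_exp]
  split_ifs <;> field_simp

/-- Folding the series at `z = exp (θ I)` onto `ℕ` counts `d = 0` twice, hence the extra `besselI 0
t`. -/
lemma hasSum_besselI_mul_cos (t θ : ℝ) :
    HasSum (fun k : ℕ => 2 * (besselI k t : ℂ) * Complex.cos (k * θ))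
      (Complex.exp ((t * Real.cos θ : ℝ) : ℂ) + besselI 0 t) := by
  have h := (hasSum_besselI_zpow t (Complex.exp_ne_zero (θ * I))).nat_add_neg
  convert h using 1
  · funext k
    simp only [Int.natAbs_neg, Int.natAbs_natCast]
    rw [← mul_add, ← Complex.exp_int_mul, ← Complex.exp_int_mul, mul_right_comm, mul_comm _ (besselI k t : ℂ),
      ← mul_assoc, mul_comm, Complex.cos]
    push_cast
    ring_nf
  · simp only [Int.natAbs_zero, zpow_zero, mul_one]
    congr 2
    rw [← Complex.exp_neg, Complex.ofReal_mul, Complex.ofReal_cos, Complex.cos]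
    ring_nf

lemma chebyshevTruncation_exp_eval_cos (t θ : ℝ) (n : ℕ) :
    (chebyshevTruncation (fun y : ℝ => Complex.exp ((t * y : ℝ) : ℂ)) n).eval
        (Complex.cos θ) =
      ∑ k ∈ Finset.range (n + 1), 2 * (besselI k t : ℂ) * Complex.cos (k * θ) - besselI 0 t := by
  simp only [chebyshevTruncation, eval_finsetSum, eval_mul, eval_C, chebyshevCoeff_exp,
    Polynomial.Chebyshev.T_complex_cos, Int.cast_natCast]
  rw [Finset.sum_range_succ', Finset.sum_range_succ']
  simp
  ring

lemma abs_besselI_le (k : ℕ) (t : ℝ) : |besselI k t| ≤ besselI k |t| := by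
  refine (norm_tsum_le_tsum_norm (summable_besselI k t).norm).trans (le_of_eq ?_)
  refine tsum_congr fun m => ?_
  simp

lemma besselI_nonneg (k : ℕ) {t : ℝ} (ht : 0 ≤ t) : 0 ≤ besselI k t :=
  tsum_nonneg fun m => by positivity

lemma hasSum_besselI_mul_exp (t s : ℝ) :
    HasSum (fun d : ℤ => besselI d.natAbs t * Real.exp (s * d)) (Real.exp (t * Real.cosh s)) := by
  have h := hasSum_besselI_zpow t (Complex.exp_ne_zero s)
  rw [← Complex.hasSum_ofReal]
  convert h using 1
  · funext d
    rw [← Complex.exp_int_mul]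
    push_cast
    ring_nf
  · rw [← Complex.exp_neg]
    push_cast
    rw [Complex.cosh]
    ring_nf

lemma summable_besselI_nat (t : ℝ) : Summable fun k : ℕ => besselI k t := by
  have h := (hasSum_besselI_mul_exp t 0).summable.comp_injective Nat.cast_injective
  simpa [Function.comp_def] using h

/-! ### Bounds for the Bessel tail -/

/-- Twice the tail of the sequence of Bessel functions, a bound for the truncation error. -/
noncomputable def besselTail (n : ℕ) (S : ℝ) : ℝ := 2 * ∑' k : ℕ, besselI (k + (n + 1)) S

lemma norm_chebyshevTruncation_exp_sub_le (t : ℝ) (n : ℕ) {x : ℝ} (hx : x ∈ Set.Icc (-1 : ℝ) 1) :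
    ‖(chebyshevTruncation (fun y : ℝ => Complex.exp ((t * y : ℝ) : ℂ)) n).eval (x : ℂ)
      - Complex.exp ((t * x : ℝ) : ℂ)‖ ≤ besselTail n |t| := by
  obtain ⟨θ, rfl⟩ : ∃ θ, Real.cos θ = x := ⟨_, Real.cos_arccos hx.1 hx.2⟩
  have h := hasSum_besselI_mul_cos t θ
  have h2 := h.summable.sum_add_tsum_nat_add (n + 1)
  rw [h.tsum_eq] at h2
  have h3 : (chebyshevTruncation (fun y : ℝ => Complex.exp ((t * y : ℝ) : ℂ)) n).eval
      ((Real.cos θ : ℝ) : ℂ) - Complex.exp ((t * Real.cos θ : ℝ) : ℂ) =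
      -∑' k : ℕ, 2 * (besselI (k + (n + 1)) t : ℂ) * Complex.cos ((k + (n + 1) : ℕ) * θ) := by
    rw [Complex.ofReal_cos, chebyshevTruncation_exp_eval_cos]
    linear_combination h2
  rw [h3, norm_neg, besselTail, ← tsum_mul_left]
  have hs : Summable fun k : ℕ => 2 * besselI (k + (n + 1)) |t| :=
    ((summable_nat_add_iff (n + 1)).2 (summable_besselI_nat |t|)).mul_left 2
  refine tsum_of_norm_bounded hs.hasSum fun k => ?_
  rw [norm_mul, norm_mul, Complex.norm_real, Complex.norm_ofNat]
  have hc : ‖Complex.cos ((k + (n + 1) : ℕ) * θ)‖ ≤ 1 := by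
    have : Complex.cos ((k + (n + 1) : ℕ) * θ) = (Real.cos ((k + (n + 1) : ℕ) * θ) : ℝ) := by
      push_cast; rfl
    rw [this, Complex.norm_real]
    exact Real.abs_cos_le_one _
  have hb := abs_besselI_le (k + (n + 1)) t
  have := mul_le_of_le_one_right (a := 2 * ‖besselI (k + (n + 1)) t‖) (by positivity) hc
  rw [Real.norm_eq_abs] at *
  linarith

/-- Term `m` on the left and term `m + 1` on the right have the same power of `t / 2`, so only
factorials are compared. A shift by one would change the parity of the powers. -/
lemma besselI_add_two_le (k : ℕ) {t : ℝ} (ht : 0 ≤ t) : besselI (k + 2) t ≤ besselI k t := by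
  have h := (summable_besselI k t).comp_injective (add_left_injective 1)
  refine (Summable.tsum_le_tsum (fun m => ?_) (summable_besselI (k + 2) t) h).trans
    (tsum_comp_le_tsum_of_inj (summable_besselI k t) (fun m => by positivity)
      (add_left_injective 1))
  simp only [Function.comp]
  rw [show 2 * (m + 1) + k = 2 * m + (k + 2) by ring]
  refine div_le_div_of_nonneg_left (by positivity) (by positivity) ?_
  have e : (m + 1).factorial * (m + 1 + k).factorial ≤ m.factorial * (m + (k + 2)).factorial := by
    rw [show m + (k + 2) = (m + 1 + k) + 1 by ring, Nat.factorial_succ m,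
      Nat.factorial_succ (m + 1 + k)]
    calc (m + 1) * m.factorial * (m + 1 + k).factorial
        = m.factorial * ((m + 1) * (m + 1 + k).factorial) := by ring
      _ ≤ _ := by gcongr; omega
  exact_mod_cast e

/-- Chernoff: all terms of the series at `z = exp s` are nonnegative, and those with `d > n` have
weight at least `exp (s * (n + 1))`. -/
lemma besselTail_le_exp (n : ℕ) {S s : ℝ} (hS : 0 ≤ S) (hs : 0 ≤ s) :
    besselTail n S ≤ 2 * Real.exp (S * Real.cosh s - s * (n + 1)) := by
  have h := hasSum_besselI_mul_exp S s
  have hi : Function.Injective fun k : ℕ => ((k + (n + 1) : ℕ) : ℤ) := fun a b hab =>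
    Nat.add_right_cancel (Int.ofNat_inj.1 hab)
  have ht : Summable fun k : ℕ => besselI (k + (n + 1)) S :=
    (summable_nat_add_iff (f := fun k => besselI k S) (n + 1)).2 (summable_besselI_nat S)
  have key : (∑' k : ℕ, besselI (k + (n + 1)) S) * Real.exp (s * (n + 1)) ≤
      Real.exp (S * Real.cosh s) := by
    refine hasSum_le_inj (f := fun k : ℕ => besselI (k + (n + 1)) S * Real.exp (s * (n + 1)))
      (g := fun d : ℤ => besselI d.natAbs S * Real.exp (s * d))
      (fun k : ℕ => ((k + (n + 1) : ℕ) : ℤ)) hi (fun d _ => ?_) (fun k => ?_) (ht.hasSum.mul_right _) h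
    · exact mul_nonneg (besselI_nonneg _ hS) (Real.exp_pos _).le
    · rw [Int.natAbs_natCast]
      refine mul_le_mul_of_nonneg_left (Real.exp_le_exp.2 ?_) (besselI_nonneg _ hS)
      push_cast
      nlinarith [(Nat.cast_nonneg k : (0 : ℝ) ≤ k)]
  rw [besselTail, Real.exp_sub]
  exact mul_le_mul_of_nonneg_left ((le_div_iff₀ (Real.exp_pos _)).2 key) zero_le_two

lemma besselTail_eq (n : ℕ) (S : ℝ) :
    besselTail n S = Real.exp S + besselI 0 S -
      2 * ∑ k ∈ Finset.range (n + 1), besselI k S := by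
  have h := (hasSum_besselI_mul_exp S 0).nat_add_neg
  simp only [zero_mul, Real.exp_zero, mul_one, Real.cosh_zero, Int.natAbs_neg,
    Int.natAbs_natCast, Int.natAbs_zero, ← two_mul] at h
  have h2 := (summable_besselI_nat S).sum_add_tsum_nat_add (n + 1)
  have h3 := h.tsum_eq
  rw [tsum_mul_left] at h3
  rw [besselTail]
  linarith

lemma besselTail_le_exp_sub_sum (n : ℕ) {S : ℝ} (hS : 0 ≤ S) :
    besselTail n S ≤ Real.exp S - ∑ k ∈ Finset.range (n + 1), besselI k S := by
  rw [besselTail_eq]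
  have : besselI 0 S ≤ ∑ k ∈ Finset.range (n + 1), besselI k S :=
    Finset.single_le_sum (f := fun k => besselI k S) (fun k _ => besselI_nonneg k hS) (by simp)
  linarith

lemma besselTail_le_exp_self (n : ℕ) {S : ℝ} (hS : 0 ≤ S) : besselTail n S ≤ Real.exp S :=
  (besselTail_le_exp_sub_sum n hS).trans
    (sub_le_self _ (Finset.sum_nonneg fun k _ => besselI_nonneg k hS))

/-- The averages of initial segments of an antitone sequence decrease. -/
lemma Antitone.mul_sum_range_le {q : ℕ → ℝ} (hq : Antitone q) {m M : ℕ} (h : m ≤ M) :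
    m * ∑ j ∈ Finset.range M, q j ≤ M * ∑ j ∈ Finset.range m, q j := by
  induction M, h using Nat.le_induction with
  | base => rfl
  | succ M hM ih =>
    have h1 : (m : ℝ) * q M ≤ ∑ j ∈ Finset.range m, q j := by
      have := Finset.card_nsmul_le_sum (Finset.range m) q (q M) fun j hj =>
        hq ((Finset.mem_range.1 hj).le.trans hM)
      simpa using this
    rw [Finset.sum_range_succ]
    push_cast
    linarith

lemma mul_sum_range_two_mul_besselI_le {S : ℝ} (hS : 0 ≤ S) {m M : ℕ} (h : m ≤ M) :
    m * ∑ k ∈ Finset.range (2 * M), besselI k S ≤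
      M * ∑ k ∈ Finset.range (2 * m), besselI k S := by
  have hpair (N : ℕ) : ∑ k ∈ Finset.range (2 * N), besselI k S =
      ∑ j ∈ Finset.range N, (besselI (2 * j) S + besselI (2 * j + 1) S) := by
    induction N with
    | zero => simp
    | succ N ih =>
      rw [mul_add, mul_one, Finset.sum_range_succ, Finset.sum_range_succ, ih,
        Finset.sum_range_succ]
      ring
  rw [hpair, hpair]
  exact Antitone.mul_sum_range_le (antitone_nat_of_succ_le fun j =>
    add_le_add (besselI_add_two_le (2 * j) hS) (besselI_add_two_le (2 * j + 1) hS)) h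

lemma cosh_le_one_add_sq {s : ℝ} (hs : |s| ≤ 1) : Real.cosh s ≤ 1 + s ^ 2 := by
  have h1 : s ^ 2 ≤ 1 := (sq_le_one_iff_abs_le_one s).2 hs
  have h2 := Real.norm_exp_sub_one_sub_id_le (x := s ^ 2 / 2)
    (by rw [Real.norm_eq_abs, abs_of_nonneg (by positivity)]; linarith)
  rw [Real.norm_eq_abs, Real.norm_eq_abs, abs_of_nonneg (a := s ^ 2 / 2) (by positivity)] at h2
  have h3 := le_of_abs_le h2
  nlinarith [Real.cosh_le_exp_half_sq s, sq_nonneg s]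

lemma two_mul_exp_le {a b : ℝ} (h : a + 1 ≤ b) : 2 * Real.exp a ≤ Real.exp b := by
  have h1 : 2 ≤ Real.exp 1 := by linarith [Real.add_one_le_exp 1]
  calc 2 * Real.exp a ≤ Real.exp 1 * Real.exp a := by gcongr
    _ = Real.exp (a + 1) := by rw [← Real.exp_add, add_comm]
    _ ≤ Real.exp b := Real.exp_le_exp.2 h

/-- Chernoff with `s = 1 / √R` makes the tail at most `2 * exp (S - 2) ≤ exp S / 2`. -/
lemma exp_half_le_sum_besselI {S R : ℝ} (hS : 0 ≤ S) (hR : 1 ≤ R) (hSR : S ≤ R) {N : ℕ}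
    (hN : 3 * √R ≤ N) : Real.exp S / 4 ≤ ∑ k ∈ Finset.range N, besselI k S := by
  have hR0 : 0 < √R := Real.sqrt_pos.2 (by linarith)
  have hR1 : 1 ≤ √R := Real.one_le_sqrt.2 hR
  have hRR : √R ^ 2 = R := Real.sq_sqrt (by linarith)
  obtain ⟨n, rfl⟩ : ∃ n, N = n + 1 := by
    refine ⟨N - 1, (Nat.succ_pred_eq_of_pos ?_).symm⟩
    exact_mod_cast (by linarith : (0 : ℝ) < N)
  have hc : Real.cosh (√R)⁻¹ ≤ 1 + (√R)⁻¹ ^ 2 :=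
    cosh_le_one_add_sq (by rw [abs_of_pos (inv_pos.2 hR0)]; exact inv_le_one_of_one_le₀ hR1)
  have hT := besselTail_le_exp n hS (inv_pos.2 hR0).le
  have hsN : 3 ≤ (√R)⁻¹ * (n + 1) := by
    push_cast at hN
    rw [inv_mul_eq_div, le_div_iff₀ hR0]; exact hN
  have hSc : S * Real.cosh (√R)⁻¹ ≤ S + 1 := by
    have : S * (√R)⁻¹ ^ 2 ≤ 1 := by
      rw [inv_pow, hRR, ← div_eq_mul_inv, div_le_one (by linarith)]; exact hSR
    nlinarith
  have h4 : 4 * Real.exp (S * Real.cosh (√R)⁻¹ - (√R)⁻¹ * (n + 1)) ≤ Real.exp S := by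
    have h1 : 4 ≤ Real.exp 2 := by
      rw [show (2 : ℝ) = 1 + 1 by norm_num, Real.exp_add]
      nlinarith [Real.add_one_le_exp 1]
    calc _ ≤ Real.exp 2 * Real.exp (S - 2) :=
          mul_le_mul h1 (Real.exp_le_exp.2 (by linarith)) (Real.exp_pos _).le (Real.exp_pos _).le
      _ = Real.exp S := by rw [← Real.exp_add]; congr 1; ring
  rw [besselTail_eq] at hT
  linarith [besselI_nonneg 0 hS]

/-! ### The two regimes of `ε` -/

lemma besselTail_le_of_le_one {S ε : ℝ} (hS : 0 < S) (hε : 0 < ε) (hε1 : ε ≤ 1) {n : ℕ}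
    (hn : 3 * (S + Real.log (1 / ε) / Real.log (Real.exp 1 + Real.log (1 / ε) / S)) ≤ n) :
    besselTail n S ≤ ε := by
  set L := Real.log (1 / ε) with hL
  have hL0 : 0 ≤ L := Real.log_nonneg (one_le_one_div hε hε1)
  have hεL : ε = Real.exp (-L) := by
    rw [hL, one_div, Real.log_inv, neg_neg, Real.exp_log hε]
  have he : 0 < Real.exp 1 + L / S := by positivity
  -- Chosen so that `S * exp s = e * S + L`. The Chernoff exponent is then at most `-2 * L - 1`.
  set s := Real.log (Real.exp 1 + L / S) with hs
  have hs1 : 1 ≤ s := by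
    rw [hs, Real.le_log_iff_exp_le he]
    linarith [div_nonneg hL0 hS.le]
  have hcosh : Real.cosh s ≤ Real.exp 1 + L / S := by
    rw [← Real.exp_log he, ← hs, Real.cosh_eq]
    have : Real.exp (-s) ≤ Real.exp s := Real.exp_le_exp.2 (by linarith)
    linarith
  have hSc : S * Real.cosh s ≤ 3 * S + L := by
    have h1 := mul_le_mul_of_nonneg_left hcosh hS.le
    have h2 : S * (Real.exp 1 + L / S) = S * Real.exp 1 + L := by field_simp
    nlinarith [Real.exp_one_lt_d9]
  have hsn : 3 * S + 3 * L + 1 ≤ s * (n + 1) := by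
    have h1 := mul_le_mul_of_nonneg_left hn (by linarith : 0 ≤ s)
    have h2 : s * (3 * (S + L / s)) = 3 * (s * S) + 3 * L := by field_simp
    nlinarith
  refine (besselTail_le_exp n hS.le (zero_le_one.trans hs1)).trans ?_
  rw [hεL]
  exact two_mul_exp_le (by linarith)

lemma besselTail_le_exp_sub {S δ : ℝ} (hδ : 0 < δ) (hδS : δ ≤ S) {n : ℕ}
    (hn : 22 * √(S * δ) ≤ n) : besselTail n S ≤ Real.exp (S - δ) := by
  have hS : 0 < S := hδ.trans_le hδS
  have hsq : √(S * δ) = √S * √δ := Real.sqrt_mul hS.le δ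
  have hS0 := Real.sqrt_pos.2 hS
  have hδ0 := Real.sqrt_pos.2 hδ
  have hSS := Real.sq_sqrt hS.le
  have hδδ := Real.sq_sqrt hδ.le
  -- For `s = √(δ / S)` the exponent is at most `S - 21 * δ`; the spare `20 * δ ≥ 1` absorbs the
  -- factor 2.
  rcases le_or_gt (1 / 20) δ with hδ1 | hδ1
  · have hs0 : 0 < √δ / √S := by positivity
    have hc : Real.cosh (√δ / √S) ≤ 1 + δ / S := by
      have h := cosh_le_one_add_sq (s := √δ / √S) (by
        rw [abs_of_pos hs0, div_le_one hS0]; exact Real.sqrt_le_sqrt hδS)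
      rwa [div_pow, hSS, hδδ] at h
    have hSc : S * Real.cosh (√δ / √S) ≤ S + δ := by
      calc S * Real.cosh (√δ / √S) ≤ S * (1 + δ / S) := by gcongr
        _ = S + δ := by field_simp
    have hsn : 22 * δ ≤ √δ / √S * n := by
      calc 22 * δ = √δ / √S * (22 * √(S * δ)) := by
            rw [hsq]; nth_rw 1 [← hδδ]; field_simp
        _ ≤ _ := by gcongr
    refine (besselTail_le_exp n hS.le hs0.le).trans (two_mul_exp_le ?_)
    nlinarith
  · have hn0 : 0 < n := by
      have : (0 : ℝ) < n := lt_of_lt_of_le (by positivity) hn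
      exact_mod_cast this
    have hn1 : (1 : ℝ) ≤ n := by exact_mod_cast hn0
    set R := max S 1 with hR
    have hR1 : 1 ≤ √R := Real.one_le_sqrt.2 (le_max_right _ _)
    set M := ⌈3 / 2 * √R⌉₊ with hM
    have hM1 : 3 / 2 * √R ≤ M := Nat.le_ceil _
    have hM2 : (M : ℝ) < 3 / 2 * √R + 1 := Nat.ceil_lt_add_one (by positivity)
    have hsumM : Real.exp S / 4 ≤ ∑ k ∈ Finset.range (2 * M), besselI k S :=
      exp_half_le_sum_besselI hS.le (le_max_right _ _) (le_max_left _ _)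
        (by push_cast; linarith)
    have hδn : 20 * √R * δ ≤ n := by
      rcases le_total S 1 with h | h
      · rw [hR, max_eq_right h, Real.sqrt_one]; linarith
      · rw [hR, max_eq_left h]
        have : √δ ≤ 1 := Real.sqrt_le_one.2 (by linarith)
        rw [hsq] at hn
        nlinarith [mul_pos hS0 hδ0]
    have hsum : δ * Real.exp S ≤ ∑ k ∈ Finset.range (n + 1), besselI k S := by
      have hmono {a b : ℕ} (h : a ≤ b) :
          ∑ k ∈ Finset.range a, besselI k S ≤ ∑ k ∈ Finset.range b, besselI k S :=
        Finset.sum_le_sum_of_subset_of_nonneg (Finset.range_mono h)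
          fun k _ _ => besselI_nonneg k hS.le
      have hE := Real.exp_pos S
      rcases le_total M ((n + 1) / 2) with h | h
      · have := hmono (show 2 * M ≤ n + 1 by omega)
        nlinarith
      -- The first `2 * M` terms sum to at least `exp S / 4`; by averaging, the first `n + 1` get at
      -- least the share `n / (2 * M)` of this.
      · have h1 := mul_sum_range_two_mul_besselI_le hS.le h
        have h2 := hmono (show 2 * ((n + 1) / 2) ≤ n + 1 by omega)
        have h3 : (n : ℝ) / 2 ≤ ((n + 1) / 2 : ℕ) := by
          rw [div_le_iff₀ two_pos]
          exact_mod_cast (by omega : n ≤ (n + 1) / 2 * 2)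
        have hM0 : (0 : ℝ) < M := by linarith
        refine le_of_mul_le_mul_left ?_ hM0
        calc (M : ℝ) * (δ * Real.exp S) ≤ (5 / 2 * √R) * (δ * Real.exp S) := by
              gcongr; linarith
          _ = 20 * √R * δ / 2 * (Real.exp S / 4) := by ring
          _ ≤ n / 2 * (Real.exp S / 4) := by gcongr
          _ ≤ ((n + 1) / 2 : ℕ) * ∑ k ∈ Finset.range (2 * M), besselI k S := by gcongr
          _ ≤ M * ∑ k ∈ Finset.range (2 * ((n + 1) / 2)), besselI k S := h1
          _ ≤ _ := by gcongr
    refine (besselTail_le_exp_sub_sum n hS.le).trans ?_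
    have h1 : (1 - δ) * Real.exp S ≤ Real.exp (-δ) * Real.exp S := by
      gcongr
      linarith [Real.add_one_le_exp (-δ)]
    rw [sub_eq_add_neg S, Real.exp_add]
    linarith

lemma besselTail_zero_right (n : ℕ) : besselTail n 0 = 0 := by
  have h (k : ℕ) : besselI (k + (n + 1)) 0 = 0 := by simp [besselI]
  simp [besselTail, h]

lemma besselTail_le_of_mul_expDegreeBound_le {t ε : ℝ} (hε : 0 < ε) {n : ℕ}
    (hn : 22 * expDegreeBound t ε ≤ n) : besselTail n |t| ≤ ε := by
  rcases eq_or_ne t 0 with rfl | ht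
  · rw [abs_zero, besselTail_zero_right]; exact hε.le
  have hS : 0 < |t| := abs_pos.2 ht
  rcases le_or_gt ε 1 with h1 | h1
  · rw [expDegreeBound, if_pos h1, if_neg ht] at hn
    refine besselTail_le_of_le_one hS hε h1 (le_trans ?_ hn)
    have hL0 : 0 ≤ Real.log (1 / ε) := Real.log_nonneg (one_le_one_div hε h1)
    have : 0 ≤ Real.log (Real.exp 1 + Real.log (1 / ε) / |t|) := Real.log_nonneg (by
      linarith [Real.add_one_le_exp 1, div_nonneg hL0 hS.le])
    gcongr
    norm_num
  · rw [expDegreeBound, if_neg (not_le.2 h1), Real.log_div (Real.exp_ne_zero _) hε.ne',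
      Real.log_exp] at hn
    have hlog := Real.log_pos h1
    -- If `ε ≥ exp |t|` every degree works, since the whole tail is at most `exp |t|`. Otherwise `δ
    -- = |t| - log ε`.
    rcases le_or_gt |t| (Real.log ε) with h2 | h2
    · exact (besselTail_le_exp_self n hS.le).trans ((Real.le_log_iff_exp_le hε).1 h2)
    · rw [max_eq_right (mul_nonneg hS.le (by linarith))] at hn
      have := besselTail_le_exp_sub (sub_pos.2 h2) (by linarith) hn
      rwa [sub_sub_cancel, Real.exp_log hε] at this

theorem theorem3p1 :
    ∃ C : ℝ, 0 < C ∧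
      ∀ (t ε : ℝ), 0 < ε →
        ∀ n : ℕ, C * expDegreeBound t ε ≤ (n : ℝ) →
          ∀ x ∈ Set.Icc (-1 : ℝ) 1,
            ‖(chebyshevTruncation (fun y : ℝ => Complex.exp ((t * y : ℝ) : ℂ)) n).eval (x : ℂ)
                - Complex.exp ((t * x : ℝ) : ℂ)‖ ≤ ε :=
  ⟨22, by norm_num, fun t _ hε n hn _ hx =>
    (norm_chebyshevTruncation_exp_sub_le t n hx).trans
      (besselTail_le_of_mul_expDegreeBound_le hε hn)⟩
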